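/- **Model.** A linear contract setting consists of finite sets of states $\mathcal Y$, actions $\mathcal A$ and outcomes $\mathbb O$, an outcome map $o:\mathcal A\times\mathcal Y\to\mathbb O$, a value function $v:\mathbb O\to[0,1]$, pairwise different costs $c:\mathcal A\to[0,1]$, the policy space $\mathcal P=[0,1]$, and a finite nonempty benchmark set $\mathcal P_0\subseteq\mathcal P$. The Agent's utility is $U(a,p,y)=p\,v(o(a,y))-c(a)$ and the Principal's is $V(a,p,y)=(1-p)\,v(o(a,y))$. For $\pi\in\Delta(\mathcal Y)$, $a^*(p,\pi)$ is an action that maximizes $\mathbb E_{y\sim\pi}[U(a,p,y)]$ and, among the maximizers, maximizes $\mathbb E_{y\sim\pi}[V(a,p,y)]$, remaining ties being broken by an arbitrary fixed rule. For a horizon $T$, a Principal mechanism $\sigma$ is a randomized procedure that in each round $t\le T$ outputs a forecast $\pi_t\in\Delta(\mathcal Y)$, a policy $p_t\in\mathcal P$ and a recommendation $r_t\in\mathcal A$, depending on $y_{1:t-1}$, its own past outputs and its internal randomness, but not on the Agent's actions. (This includes the mechanisms with $p_t=\psi(\pi_t)$ and $r_t=a^*(p_t,\pi_t)$ for a rule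 $\psi$.) The constant mechanism $p_0\in\mathcal P_0$ always plays $p_0$ and recommends $r_t^{p_0}=a^*(p_0,\pi_t)$, with the same forecasts $\pi_t$. An Agent learning algorithm $\mathcal L$ maps $(y_{1:t-1},a_{1:t-1},r_{1:t},p_{1:t})$ to a distribution over $\mathcal A$ from which $a_t$ is drawn. Its contextual swap regret is $$\mathrm{SwapReg}(y_{1:T},p_{1:T},r_{1:T})=\mathbb E_{a_{1:T}}\Big[\max_{h:\mathcal P\times\mathcal A\times\mathcal A\to\mathcal A}\frac1T\sum_{t=1}^T\big(U(h(p_t,r_t,a_t),p_t,y_t)-U(a_t,p_t,y_t)\big)\Big].$$ Mechanisms and algorithms may depend on the horizon $T$. We say that $\mathcal L$ has contextual swap regret $o(1)$ against $\sigma$ if there is $\varepsilon_T\to0$ such that for all $T$ and all $y_{1:T}\in\mathcal Y^T$, for almost every realization of $\sigma$ on $y_{1:T}$, $\mathrm{SwapReg}(y_{1:T},p_{1:T},r_{1:T})\le\varepsilon_T$ and $\mathrm{SwapReg}(y_{1:T},(p_0,\dots,p_0),r^{p_0}_{1:T})\le\varepsilon_T$ for all $p_0\in\mathcal P_0$. The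 Principal's policy regret is $$\mathrm{PR}(\sigma,\mathcal L,y_{1:T})=\mathbb E_{\sigma}\Big[\max_{p_0\in\mathcal P_0}\mathbb E_{a_{1:T},a^{p_0}_{1:T}}\Big[\frac1T\sum_{t=1}^T\big(V(a_t^{p_0},p_0,y_t)-V(a_t,p_t,y_t)\big)\Big]\Big],$$ where $a_{1:T}$ and $a^{p_0}_{1:T}$ are generated by $\mathcal L$ in response to $\sigma$ and to the constant mechanism $p_0$ respectively. **Proposition.** There is a linear contract setting with two states, two actions and two outcomes such that for every Principal mechanism $\sigma$ one of the following holds: 1. no learning algorithm $\mathcal L$ has contextual swap regret $o(1)$ against $\sigma$; or 2. there are a learning algorithm $\mathcal L^*$ with contextual swap regret $o(1)$ against $\sigma$, state sequences $\bar y_{1:T}\in\mathcal Y^T$ (one for each $T$) and a constant $c>0$ such that $\mathrm{PR}(\sigma,\mathcal L^*,\bar y_{1:T})\ge c$ for all sufficiently large $T$. -/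

import Mathlib

open MeasureTheory Filter Topology

noncomputable section

namespace PrincipalAgent

/-- The data of a linear contract problem with states `Y`, actions `A` and outcomes `O`.
Policies are the linear contracts `p ∈ [0,1]` (`unitInterval`); `benchmarks` is the finite set of
policies against which the Principal's policy regret is measured. -/
structure LinearContractSetting (Y A O : Type) where
  outcome : A → Y → O
  value : O → ℝ
  value_mem : ∀ o, value o ∈ Set.Icc (0 : ℝ) 1
  cost : A → ℝ
  cost_mem : ∀ a, cost a ∈ Set.Icc (0 : ℝ) 1
  cost_injective : Function.Injective cost
  benchmarks : Finset unitInterval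
  benchmarks_nonempty : benchmarks.Nonempty

section Utilities

variable {Y A O : Type}

/-- The Agent's utility `U(a,p,y) = p · v(o(a,y)) - c(a)`. -/
def LinearContractSetting.agentUtility (S : LinearContractSetting Y A O)
    (a : A) (p : unitInterval) (y : Y) : ℝ :=
  (p : ℝ) * S.value (S.outcome a y) - S.cost a

/-- The Principal's utility `V(a,p,y) = (1 - p) · v(o(a,y))`. -/
def LinearContractSetting.principalUtility (S : LinearContractSetting Y A O)
    (a : A) (p : unitInterval) (y : Y) : ℝ :=
  (1 - (p : ℝ)) * S.value (S.outcome a y)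

variable [Fintype Y]

/-- `U(a,p,π)`, the expected utility of the Agent when the state is drawn from `π`. -/
def LinearContractSetting.agentUtilityExp (S : LinearContractSetting Y A O)
    (a : A) (p : unitInterval) (π : stdSimplex ℝ Y) : ℝ :=
  ∑ y, (π : Y → ℝ) y * S.agentUtility a p y

/-- `V(a,p,π)`, the expected utility of the Principal when the state is drawn from `π`. -/
def LinearContractSetting.principalUtilityExp (S : LinearContractSetting Y A O)
    (a : A) (p : unitInterval) (π : stdSimplex ℝ Y) : ℝ :=
  ∑ y, (π : Y → ℝ) y * S.principalUtility a p y

/-- `a` maximizes the Agent's expected utility under the prior `π`. -/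
def LinearContractSetting.IsAgentOptimal (S : LinearContractSetting Y A O)
    (p : unitInterval) (π : stdSimplex ℝ Y) (a : A) : Prop :=
  ∀ b, S.agentUtilityExp b p π ≤ S.agentUtilityExp a p π

/-- `a` is an optimal action of the Agent under the prior `π` and, among all those, one that is
best for the Principal. -/
def LinearContractSetting.IsBestResponse (S : LinearContractSetting Y A O)
    (p : unitInterval) (π : stdSimplex ℝ Y) (a : A) : Prop :=
  S.IsAgentOptimal p π a ∧
    ∀ b, S.IsAgentOptimal p π b → S.principalUtilityExp b p π ≤ S.principalUtilityExp a p π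

/-- A best-response rule `a*(p,π)`: a (Borel measurable) selection among the best responses, with
the remaining ties broken arbitrarily. -/
structure BestResponseRule (S : LinearContractSetting Y A O) where
  act : unitInterval → stdSimplex ℝ Y → A
  isBestResponse : ∀ p π, S.IsBestResponse p π (act p π)
  measurable_act : ∀ p a, MeasurableSet {π | act p π = a}

/-- A best-response rule exists for all finite sets of states and actions. -/
theorem nonempty_bestResponseRule [Finite A] [Nonempty A] (S : LinearContractSetting Y A O) :
    Nonempty (BestResponseRule S) := by
  classical
  have hU : ∀ a p, Measurable fun π : stdSimplex ℝ Y => S.agentUtilityExp a p π := fun a p =>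
    Finset.measurable_sum _ fun y _ =>
      ((measurable_pi_apply y).comp measurable_subtype_coe).mul_const _
  have hV : ∀ a p, Measurable fun π : stdSimplex ℝ Y => S.principalUtilityExp a p π := fun a p =>
    Finset.measurable_sum _ fun y _ =>
      ((measurable_pi_apply y).comp measurable_subtype_coe).mul_const _
  have hAll : ∀ q : A → stdSimplex ℝ Y → Prop, (∀ b, MeasurableSet {π | q b π}) →
      MeasurableSet {π | ∀ b, q b π} := fun q hq => by
    rw [Set.ofPred_forall]
    exact MeasurableSet.iInter hq
  have hOpt : ∀ p a, MeasurableSet {π | S.IsAgentOptimal p π a} := fun p a =>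
    hAll _ fun b => measurableSet_le (hU b p) (hU a p)
  have hBest : ∀ p a, MeasurableSet {π | S.IsBestResponse p π a} := fun p a =>
    (hOpt p a).inter (hAll _ fun b =>
      MeasurableSet.imp (hOpt p b) (measurableSet_le (hV b p) (hV a p)))
  have hne : ∀ p π, {a | S.IsBestResponse p π a}.Nonempty := fun p π => by
    obtain ⟨a₀, ha₀⟩ := Finite.exists_max fun a => S.agentUtilityExp a p π
    obtain ⟨a, ha, hmax⟩ := Set.exists_max_image {a | S.IsAgentOptimal p π a}
      (fun a => S.principalUtilityExp a p π) (Set.toFinite _) ⟨a₀, ha₀⟩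
    exact ⟨a, ha, hmax⟩
  let pick : Set A → A := fun s => if h : s.Nonempty then h.choose else Classical.arbitrary A
  have hpick : ∀ s : Set A, s.Nonempty → pick s ∈ s := fun s h => by
    simp only [pick, dif_pos h]; exact h.choose_spec
  refine ⟨⟨fun p π => pick {a | S.IsBestResponse p π a}, fun p π => hpick _ (hne p π), ?_⟩⟩
  intro p a
  have hset : {π | pick {a | S.IsBestResponse p π a} = a} =
      ⋃ s ∈ {s : Set A | pick s = a}, ⋂ b, {π | S.IsBestResponse p π b ↔ b ∈ s} := by
    ext π
    simp only [Set.mem_ofPred_eq, Set.mem_iUnion, Set.mem_iInter, exists_prop]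
    constructor
    · intro h
      exact ⟨_, h, fun b => Iff.rfl⟩
    · rintro ⟨s, hs, h⟩
      rw [show {a | S.IsBestResponse p π a} = s from Set.ext h, hs]
  rw [hset]
  refine MeasurableSet.biUnion (Set.to_countable _) fun s _ => MeasurableSet.iInter fun b => ?_
  by_cases hb : b ∈ s
  · simpa [hb] using hBest p b
  · simp only [hb, iff_false]; exact (hBest p b).compl

end Utilities

section Histories

variable {α : Type} {T : ℕ}

/-- The entries of `x` strictly before round `t`. -/
def before (x : Fin T → α) (t : Fin T) : Fin (t : ℕ) → α :=
  fun s => x (Fin.castLE t.isLt.le s)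

/-- The entries of `x` up to and including round `t`. -/
def upTo (x : Fin T → α) (t : Fin T) : Fin ((t : ℕ) + 1) → α :=
  fun s => x (Fin.castLE t.isLt s)

end Histories

/-- A randomized mechanism of the Principal for `T` rounds. `Ω` carries its internal randomness.
In each round it issues a forecast, a policy and a recommendation, which depend on the earlier
states and on the internal randomness (hence possibly on the mechanism's own earlier outputs), but
never on the Agent's actions. Mechanisms given by a forecasting algorithm and a choice rule `ψ`
are those with `policy = ψ (forecast)` and `recommendation = a*(policy, forecast)`. -/
structure Mechanism (Y A : Type) [Fintype Y] (T : ℕ) where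
  Ω : Type
  [measurableSpace : MeasurableSpace Ω]
  μ : Measure Ω
  [isProbabilityMeasure : IsProbabilityMeasure μ]
  forecast : (t : Fin T) → (Fin (t : ℕ) → Y) → Ω → stdSimplex ℝ Y
  policy : (t : Fin T) → (Fin (t : ℕ) → Y) → Ω → unitInterval
  recommendation : (t : Fin T) → (Fin (t : ℕ) → Y) → Ω → A
  measurable_forecast : ∀ t h, Measurable (forecast t h)
  measurable_policy : ∀ t h, Measurable (policy t h)
  measurable_recommendation : ∀ t h a, MeasurableSet {ω | recommendation t h ω = a}

attribute [instance] Mechanism.measurableSpace Mechanism.isProbabilityMeasure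

/-- A learning algorithm of the Agent for `T` rounds: from the earlier states, his own earlier
actions, and the recommendations and policies up to and including the current round, it produces
a distribution over actions. -/
structure AgentAlgorithm (Y A : Type) (T : ℕ) where
  act : (t : Fin T) → (Fin (t : ℕ) → Y) → (Fin (t : ℕ) → A) →
    (Fin ((t : ℕ) + 1) → A) → (Fin ((t : ℕ) + 1) → unitInterval) → PMF A
  measurable_act : ∀ t y a r b, Measurable fun p => act t y a r p b

section Play

variable {Y A O : Type} [Fintype Y] {T : ℕ}

/-- The realized policies `p_{1:T}` on the state sequence `y`. -/
def Mechanism.policies (σ : Mechanism Y A T) (y : Fin T → Y) (ω : σ.Ω) : Fin T → unitInterval :=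
  fun t => σ.policy t (before y t) ω

/-- The realized recommendations `r_{1:T}` on the state sequence `y`. -/
def Mechanism.recommendations (σ : Mechanism Y A T) (y : Fin T → Y) (ω : σ.Ω) : Fin T → A :=
  fun t => σ.recommendation t (before y t) ω

/-- The recommendations `a*(p₀, π_t)` issued by the constant mechanism `p₀`, for the realized
forecasts `π_t`. -/
def Mechanism.constRecommendations {S : LinearContractSetting Y A O} (br : BestResponseRule S)
    (σ : Mechanism Y A T) (p₀ : unitInterval) (y : Fin T → Y) (ω : σ.Ω) : Fin T → A :=
  fun t => br.act p₀ (σ.forecast t (before y t) ω)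

/-- The probability that the Agent plays `a_{1:T}` when the states, policies and recommendations
are `y`, `p`, `r`. -/
def AgentAlgorithm.actionProb (L : AgentAlgorithm Y A T)
    (y : Fin T → Y) (p : Fin T → unitInterval) (r a : Fin T → A) : ℝ :=
  ∏ t, (L.act t (before y t) (before a t) (upTo r t) (upTo p t) (a t)).toReal

variable [Fintype A]

/-- The expectation of `f(a_{1:T})` over the Agent's random actions. -/
def AgentAlgorithm.expect (L : AgentAlgorithm Y A T)
    (y : Fin T → Y) (p : Fin T → unitInterval) (r : Fin T → A) (f : (Fin T → A) → ℝ) : ℝ :=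
  ∑ a, L.actionProb y p r a * f a

/-- The Agent's contextual swap regret. The supremum, over the modification rules
`h : P × A × A → A`, is a maximum: only finitely many values of `h` matter. -/
def swapRegret (S : LinearContractSetting Y A O) (L : AgentAlgorithm Y A T)
    (y : Fin T → Y) (p : Fin T → unitInterval) (r : Fin T → A) : ℝ :=
  L.expect y p r fun a =>
    ⨆ h : unitInterval → A → A → A, (1 / (T : ℝ)) *
      ∑ t, (S.agentUtility (h (p t) (r t) (a t)) (p t) (y t) - S.agentUtility (a t) (p t) (y t))

/-- On the state sequence `y`, the contextual swap regret is at most `ε`, both for (almost) every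
realization of the deployed mechanism and for the corresponding run of each constant mechanism. -/
def SwapRegretLE (S : LinearContractSetting Y A O) (br : BestResponseRule S)
    (σ : Mechanism Y A T) (L : AgentAlgorithm Y A T) (y : Fin T → Y) (ε : ℝ) : Prop :=
  ∀ᵐ ω ∂σ.μ, swapRegret S L y (σ.policies y ω) (σ.recommendations y ω) ≤ ε ∧
    ∀ p₀ ∈ S.benchmarks, swapRegret S L y (fun _ => p₀) (σ.constRecommendations br p₀ y ω) ≤ ε

/-- The Principal's expected average utility, over the Agent's random actions. -/
def principalPayoff (S : LinearContractSetting Y A O) (L : AgentAlgorithm Y A T)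
    (y : Fin T → Y) (p : Fin T → unitInterval) (r : Fin T → A) : ℝ :=
  L.expect y p r fun a => (1 / (T : ℝ)) * ∑ t, S.principalUtility (a t) (p t) (y t)

/-- The Principal's policy regret `PR(σ, L, y_{1:T})`: the expectation over the mechanism's
randomness of the maximal gain from having used a constant benchmark policy, to which the Agent
would have responded by the same algorithm. -/
def policyRegret (S : LinearContractSetting Y A O) (br : BestResponseRule S)
    (σ : Mechanism Y A T) (L : AgentAlgorithm Y A T) (y : Fin T → Y) : ℝ :=
  ∫ ω, S.benchmarks.sup' S.benchmarks_nonempty (fun p₀ =>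
    principalPayoff S L y (fun _ => p₀) (σ.constRecommendations br p₀ y ω)
      - principalPayoff S L y (σ.policies y ω) (σ.recommendations y ω)) ∂σ.μ

/-- The learning algorithm `L` (one for each horizon) has contextual swap regret `o(1)` against
`σ`, uniformly over all state sequences. -/
def VanishingSwapRegret (S : LinearContractSetting Y A O) (br : BestResponseRule S)
    (σ : (T : ℕ) → Mechanism Y A T) (L : (T : ℕ) → AgentAlgorithm Y A T) : Prop :=
  ∃ ε : ℕ → ℝ, Tendsto ε atTop (𝓝 0) ∧
    ∀ (T : ℕ) (y : Fin T → Y), SwapRegretLE S br (σ T) (L T) y (ε T)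

end Play

end PrincipalAgent

end

/-! Effort costs 1/4 and succeeds only in state 1. Swap regret must be small on all state sequences,
yet an Agent who secretly knows one sequence `ybar` may exploit this under a single policy `q` and
use his original algorithm `L` elsewhere. If `q ≥ 1/4`, effort in rounds of state 1 never hurts him,
and his knowledge fails at most once, in the round where the states leave `ybar`; the regret of `L`
grows by at most `2 / T` (`swapRegret_relabel_informedEffort_le`).

Under constant `q` the Principal thus collects `1 - q` in every round of state 1. In a round with
another policy `p`, the mechanism faces `L`, which cannot foresee the state. Averaged over uniform
states, it either offers `p ≥ 1/2`, keeping too little, or `p < 1/2`, where effort with probability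
`w` causes regret `(1/4 - p/2) w`. Gain plus regret is at least 1/16 per such round
(`half_gain_add_regret_ge`, `sum_benchmarkGain_add_swapRegret_ge`).

No round can play both benchmarks 1/3 and 3/8, so one of them is avoided in at least half of the
rounds in expectation. With it as `q`, some `ybar` gives policy regret at least `1/32 - ε`.

An Agent algorithm sees only its own past actions, not the hidden actions of `L`; `relabel`
therefore realizes the modified play through conditional distributions, and `expect_relabel` reduces
it to `L`. -/

noncomputable section

namespace PrincipalAgent

/-! ### Causality: what the law of the first actions depends on. -/

section Causality

variable {Y A : Type} {T : ℕ}

theorem before_congr {α : Type} {x x' : Fin T → α} {t : Fin T} (h : ∀ s < t, x s = x' s) :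
    before x t = before x' t :=
  funext fun s => h _ (by simp [Fin.lt_def])

theorem upTo_congr {α : Type} {x x' : Fin T → α} {t : Fin T} (h : ∀ s ≤ t, x s = x' s) :
    upTo x t = upTo x' t :=
  funext fun s => h _ (by have := s.isLt; simp [Fin.le_def]; omega)

/-- Continue a partial sequence by a constant. -/
def extend {α : Type} (d : α) {n : ℕ} (h : Fin n → α) : Fin T → α :=
  fun s => if hs : (s : ℕ) < n then h ⟨s, hs⟩ else d

theorem extend_before {α : Type} (d : α) (x : Fin T → α) {s t : Fin T} (h : s < t) :
    extend d (before x t) s = x s := by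
  simp [extend, Fin.lt_def.1 h, before]

theorem extend_upTo {α : Type} (d : α) (x : Fin T → α) {s t : Fin T} (h : s ≤ t) :
    extend d (upTo x t) s = x s := by
  simp [extend, Nat.lt_succ_of_le (Fin.le_def.1 h), upTo]

theorem measurable_extend {α : Type} [MeasurableSpace α] (d : α) {n : ℕ} :
    Measurable fun h : Fin n → α => (extend d h : Fin T → α) := by
  refine measurable_pi_lambda _ fun s => ?_
  by_cases hs : (s : ℕ) < n
  · simpa [extend, hs] using measurable_pi_apply _
  · simp [extend, hs]

theorem measurable_upTo {α : Type} [MeasurableSpace α] (t : Fin T) :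
    Measurable fun x : Fin T → α => upTo x t :=
  measurable_pi_lambda _ fun _ => measurable_pi_apply _

/-- The conditional probability of the action `a_t` at round `t`, given the past. -/
def AgentAlgorithm.stepProb (L : AgentAlgorithm Y A T) (y : Fin T → Y) (p : Fin T → unitInterval)
    (r a : Fin T → A) (t : Fin T) : ENNReal :=
  L.act t (before y t) (before a t) (upTo r t) (upTo p t) (a t)

/-- The probability of the action sequence `a`, as an extended nonnegative real. -/
def AgentAlgorithm.prob (L : AgentAlgorithm Y A T) (y : Fin T → Y) (p : Fin T → unitInterval)
    (r a : Fin T → A) : ENNReal :=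
  ∏ t, L.stepProb y p r a t

theorem AgentAlgorithm.toReal_prob (L : AgentAlgorithm Y A T) (y : Fin T → Y)
    (p : Fin T → unitInterval) (r a : Fin T → A) :
    (L.prob y p r a).toReal = L.actionProb y p r a :=
  ENNReal.toReal_prod _ _

theorem AgentAlgorithm.stepProb_congr (L : AgentAlgorithm Y A T) {y y' : Fin T → Y}
    {p p' : Fin T → unitInterval} {r r' a a' : Fin T → A} {t : Fin T}
    (hy : ∀ s < t, y s = y' s) (hp : ∀ s ≤ t, p s = p' s) (hr : ∀ s ≤ t, r s = r' s)
    (ha : ∀ s ≤ t, a s = a' s) : L.stepProb y p r a t = L.stepProb y' p' r' a' t := by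
  unfold stepProb
  rw [before_congr hy, upTo_congr hp, upTo_congr hr, before_congr fun s hs => ha s hs.le,
    ha t le_rfl]

theorem AgentAlgorithm.prob_le_one (L : AgentAlgorithm Y A T) (y : Fin T → Y)
    (p : Fin T → unitInterval) (r a : Fin T → A) : L.prob y p r a ≤ 1 :=
  Finset.prod_le_one' fun _ _ => PMF.coe_le_one _ _

theorem AgentAlgorithm.measurable_prob (L : AgentAlgorithm Y A T) (y : Fin T → Y)
    (r a : Fin T → A) : Measurable fun p => L.prob y p r a :=
  Finset.measurable_prod _ fun t _ => (L.measurable_act t _ _ _ _).comp (measurable_upTo t)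

/-- `g` depends only on the first `n` entries. -/
def DependsOnFirst {α : Type} (n : ℕ) (g : (Fin T → A) → α) : Prop :=
  ∀ a a', (∀ s : Fin T, (s : ℕ) < n → a s = a' s) → g a = g a'

theorem DependsOnFirst.update {α : Type} {n : ℕ} {g : (Fin T → A) → α} (hg : DependsOnFirst n g)
    {t : Fin T} (ht : n ≤ t) (a : Fin T → A) (b : A) : g (Function.update a t b) = g a :=
  hg _ _ fun s hs => Function.update_of_ne (by rintro rfl; omega) _ _

variable [Fintype A] [DecidableEq A]

/-- Summing out one coordinate. -/
theorem sum_mul_update {n : Fin T} (d : A) (F : (Fin T → A) → ENNReal)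
    (q : (Fin T → A) → A → ENNReal) (hF : ∀ a b, F (Function.update a n b) = F a)
    (hq : ∀ a b, q (Function.update a n b) = q a) (hsum : ∀ a, ∑ b, q a b = 1) :
    ∑ a, F a * q a (a n) = ∑ a, F a * (if a n = d then 1 else 0) := by
  -- A sequence is encoded by its copy reset to `d` at round `n`, together with the entry that was
  -- erased.
  have key : ∀ G : (Fin T → A) → ENNReal,
      ∑ a, G a = ∑ a, ∑ b, if a n = d then G (Function.update a n b) else 0 := by
    intro G
    rw [← Fintype.sum_prod_type']
    rw [← Finset.sum_filter (fun x : (Fin T → A) × A => x.1 n = d)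
      (fun x => G (Function.update x.1 n x.2))]
    refine Finset.sum_nbij' (fun a => (Function.update a n d, a n))
      (fun x => Function.update x.1 n x.2) ?_ ?_ ?_ ?_ ?_
    · simp
    · simp
    · simp
    · rintro ⟨a, b⟩ h
      simp only [Finset.mem_filter, Finset.mem_univ, true_and] at h
      simp [← h]
    · simp
  rw [key]
  refine Finset.sum_congr rfl fun a _ => ?_
  by_cases h : a n = d
  · simp [h, hF, hq, ← Finset.mul_sum, hsum]
  · simp [h]

/-- The probability of the first `n` actions of `a`, where later actions must equal `d`. -/
def AgentAlgorithm.prefixProb (L : AgentAlgorithm Y A T) (d : A) (n : ℕ) (y : Fin T → Y)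
    (p : Fin T → unitInterval) (r a : Fin T → A) : ENNReal :=
  ∏ t : Fin T, if (t : ℕ) < n then L.stepProb y p r a t else if a t = d then 1 else 0

/-- Round `n` is the last one governed by `L`: earlier factors and `g` do not see its action, later
factors are indicators, and its conditional probabilities sum to 1. -/
theorem AgentAlgorithm.sum_prefixProb_succ (L : AgentAlgorithm Y A T) (d : A) {n : ℕ} (hn : n < T)
    (y : Fin T → Y) (p : Fin T → unitInterval) (r : Fin T → A) {g : (Fin T → A) → ENNReal}
    (hg : DependsOnFirst n g) :
    ∑ a, L.prefixProb d (n + 1) y p r a * g a = ∑ a, L.prefixProb d n y p r a * g a := by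
  set t : Fin T := ⟨n, hn⟩
  set F : (Fin T → A) → ENNReal := fun a =>
    (∏ s ∈ Finset.univ.erase t,
      if (s : ℕ) < n then L.stepProb y p r a s else if a s = d then 1 else 0) * g a
  set q : (Fin T → A) → A → ENNReal := fun a =>
    L.act t (before y t) (before a t) (upTo r t) (upTo p t)
  have hne : ∀ s ∈ Finset.univ.erase t, (s : ℕ) ≠ n := fun s hs h =>
    (Finset.mem_erase.1 hs).1 (Fin.ext h)
  have hF : ∀ a b, F (Function.update a t b) = F a := fun a b => by
    simp only [F]
    rw [hg.update le_rfl]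
    congr 1
    refine Finset.prod_congr rfl fun s hs => ?_
    have hs' := Finset.ne_of_mem_erase hs
    rw [Function.update_of_ne hs']
    split_ifs with h
    · exact L.stepProb_congr (fun _ _ => rfl) (fun _ _ => rfl) (fun _ _ => rfl) fun u hu =>
        Function.update_of_ne (by rintro rfl; exact absurd (Fin.le_def.1 hu) (by simp [t, h])) _ _
    all_goals rfl
  have hq : ∀ a b, q (Function.update a t b) = q a := fun a b => by
    simp only [q]
    rw [before_congr fun s hs => Function.update_of_ne hs.ne _ _]
  have hsum : ∀ a, ∑ b, q a b = 1 := fun a => by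
    rw [← tsum_fintype (L := .unconditional _)]; exact PMF.tsum_coe _
  have := sum_mul_update d F q hF hq hsum
  convert this using 2 with a _ a _
  · unfold prefixProb
    rw [← Finset.mul_prod_erase _ _ (Finset.mem_univ t), if_pos (by simp [t])]
    have hlt : ∀ s ∈ Finset.univ.erase t, (if (s : ℕ) < n + 1 then L.stepProb y p r a s
        else if a s = d then 1 else 0) =
        if (s : ℕ) < n then L.stepProb y p r a s else if a s = d then 1 else 0 := fun s hs => by
      have := hne s hs
      simp only [show (s : ℕ) < n + 1 ↔ (s : ℕ) < n by omega]
    rw [Finset.prod_congr rfl hlt]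
    simp only [F, q, stepProb]; ring
  · unfold prefixProb
    rw [← Finset.mul_prod_erase _ _ (Finset.mem_univ t), if_neg (by simp [t])]
    simp only [F]; ring

/-- The rounds from the last down to `n` are summed out one at a time. Padding by `d` keeps the sum
over sequences of full length. -/
theorem AgentAlgorithm.sum_prob_mul (L : AgentAlgorithm Y A T) (d : A) {n : ℕ} (hn : n ≤ T)
    (y : Fin T → Y) (p : Fin T → unitInterval) (r : Fin T → A) {g : (Fin T → A) → ENNReal}
    (hg : DependsOnFirst n g) :
    ∑ a, L.prob y p r a * g a = ∑ a, L.prefixProb d n y p r a * g a := by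
  induction hn using Nat.decreasingInduction with
  | self => simp [prefixProb, prob]
  | of_succ k hk ih =>
    rw [ih fun a a' h => hg a a' fun s hs => h s (by omega), L.sum_prefixProb_succ d hk _ _ _ hg]

theorem AgentAlgorithm.sum_prob [Nonempty A] (L : AgentAlgorithm Y A T) (y : Fin T → Y)
    (p : Fin T → unitInterval) (r : Fin T → A) : ∑ a, L.prob y p r a = 1 := by
  have d : A := Classical.arbitrary A
  have := L.sum_prob_mul d (Nat.zero_le T) y p r (g := fun _ => 1) fun _ _ _ => rfl
  simp only [mul_one] at this
  rw [this, Finset.sum_eq_single fun _ => d]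
  · simp [prefixProb]
  · intro b _ hb
    obtain ⟨t, ht⟩ := Function.ne_iff.1 hb
    exact Finset.prod_eq_zero (Finset.mem_univ t) (by simp [ht])
  · simp

/-- The law of the first `n` actions depends only on what the Agent has observed before choosing
them. -/
theorem AgentAlgorithm.sum_prob_mul_congr [Nonempty A] (L : AgentAlgorithm Y A T) {n : ℕ}
    (hn : n ≤ T) {y y' : Fin T → Y} {p p' : Fin T → unitInterval} {r r' : Fin T → A}
    {g : (Fin T → A) → ENNReal} (hg : DependsOnFirst n g)
    (hy : ∀ s : Fin T, (s : ℕ) + 1 < n → y s = y' s)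
    (hp : ∀ s : Fin T, (s : ℕ) < n → p s = p' s) (hr : ∀ s : Fin T, (s : ℕ) < n → r s = r' s) :
    ∑ a, L.prob y p r a * g a = ∑ a, L.prob y' p' r' a * g a := by
  have d : A := Classical.arbitrary A
  rw [L.sum_prob_mul d hn _ _ _ hg, L.sum_prob_mul d hn _ _ _ hg]
  refine Finset.sum_congr rfl fun a _ => ?_
  congr 1
  refine Finset.prod_congr rfl fun t _ => ?_
  split_ifs with h
  · exact L.stepProb_congr (fun s hs => hy s (by have := Fin.lt_def.1 hs; omega))
      (fun s hs => hp s (by have := Fin.le_def.1 hs; omega))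
      (fun s hs => hr s (by have := Fin.le_def.1 hs; omega)) fun _ _ => rfl
  all_goals rfl

end Causality

/-! ### Relabelling the actions of an algorithm. -/

section Relabel

/-- A rule that replaces the action of each round by another one, as a function of the earlier
states and the current policy. -/
structure Relabelling (Y A : Type) (T : ℕ) where
  map : (t : Fin T) → (Fin (t : ℕ) → Y) → unitInterval → A → A
  measurableSet_map : ∀ t h a b, MeasurableSet {p | map t h p a = b}

variable {Y A : Type} {T : ℕ}

/-- The relabelled action sequence. -/
def Relabelling.apply (φ : Relabelling Y A T) (y : Fin T → Y) (p : Fin T → unitInterval)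
    (a : Fin T → A) : Fin T → A :=
  fun t => φ.map t (before y t) (p t) (a t)

theorem Relabelling.apply_congr (φ : Relabelling Y A T) {y y' : Fin T → Y}
    {p p' : Fin T → unitInterval} {a a' : Fin T → A} {t : Fin T} (hy : ∀ s < t, y s = y' s)
    (hp : p t = p' t) (ha : a t = a' t) : φ.apply y p a t = φ.apply y' p' a' t := by
  simp [apply, before_congr hy, hp, ha]

variable [Fintype A] [DecidableEq A]

/-- The probability that the first `n` relabelled actions are those of `a`. -/
def AgentAlgorithm.relabelledPrefix (L : AgentAlgorithm Y A T) (φ : Relabelling Y A T) (n : ℕ)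
    (y : Fin T → Y) (p : Fin T → unitInterval) (r a : Fin T → A) : ENNReal :=
  ∑ a', L.prob y p r a' *
    if ∀ s : Fin T, (s : ℕ) < n → φ.apply y p a' s = a s then 1 else 0

/-- This makes `relabel` legitimate: the quantity can be computed from the history available at the
time, completed arbitrarily. The states needed stop one round earlier because an action precedes the
state of its round. -/
theorem AgentAlgorithm.relabelledPrefix_congr [Nonempty A] (L : AgentAlgorithm Y A T)
    (φ : Relabelling Y A T) {n : ℕ} (hn : n ≤ T) {y y' : Fin T → Y} {p p' : Fin T → unitInterval}
    {r r' a a' : Fin T → A} (hy : ∀ s : Fin T, (s : ℕ) + 1 < n → y s = y' s)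
    (hp : ∀ s : Fin T, (s : ℕ) < n → p s = p' s) (hr : ∀ s : Fin T, (s : ℕ) < n → r s = r' s)
    (ha : ∀ s : Fin T, (s : ℕ) < n → a s = a' s) :
    L.relabelledPrefix φ n y p r a = L.relabelledPrefix φ n y' p' r' a' := by
  unfold relabelledPrefix
  rw [L.sum_prob_mul_congr hn ?_ hy hp hr]
  · refine Finset.sum_congr rfl fun b _ => ?_
    congr 1
    refine if_congr (forall_congr' fun s => forall_congr' fun hs => ?_) rfl rfl
    rw [ha s hs, φ.apply_congr (fun u hu => hy u (by have := Fin.lt_def.1 hu; omega)) (hp s hs) rfl]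
  · intro b b' h
    refine if_congr (forall_congr' fun s => forall_congr' fun hs => ?_) rfl rfl
    rw [φ.apply_congr (fun _ _ => rfl) rfl (h s hs)]

theorem AgentAlgorithm.relabelledPrefix_zero [Nonempty A] (L : AgentAlgorithm Y A T)
    (φ : Relabelling Y A T) (y : Fin T → Y) (p : Fin T → unitInterval) (r a : Fin T → A) :
    L.relabelledPrefix φ 0 y p r a = 1 := by
  simp [relabelledPrefix, L.sum_prob]

theorem AgentAlgorithm.relabelledPrefix_le_one [Nonempty A] (L : AgentAlgorithm Y A T)
    (φ : Relabelling Y A T) (n : ℕ) (y : Fin T → Y) (p : Fin T → unitInterval) (r a : Fin T → A) :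
    L.relabelledPrefix φ n y p r a ≤ 1 := by
  rw [← L.sum_prob y p r]
  exact Finset.sum_le_sum fun b _ => mul_le_of_le_one_right' (by split_ifs <;> simp)

theorem AgentAlgorithm.relabelledPrefix_anti (L : AgentAlgorithm Y A T)
    (φ : Relabelling Y A T) (n : ℕ) (y : Fin T → Y) (p : Fin T → unitInterval) (r a : Fin T → A) :
    L.relabelledPrefix φ (n + 1) y p r a ≤ L.relabelledPrefix φ n y p r a := by
  refine Finset.sum_le_sum fun b _ => mul_le_mul_right ?_ _
  split_ifs with h h'
  · exact le_rfl
  · exact absurd (fun s hs => h s (Nat.lt_succ_of_lt hs)) h'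
  all_goals simp

/-- Each hidden run has exactly one relabelled action at round `t`. Hence the conditional
distributions in `relabel` have mass 1. -/
theorem AgentAlgorithm.sum_relabelledPrefix_update (L : AgentAlgorithm Y A T)
    (φ : Relabelling Y A T) (t : Fin T) (y : Fin T → Y) (p : Fin T → unitInterval)
    (r a : Fin T → A) :
    ∑ b, L.relabelledPrefix φ (t + 1) y p r (Function.update a t b) =
      L.relabelledPrefix φ t y p r a := by
  unfold relabelledPrefix
  rw [Finset.sum_comm]
  refine Finset.sum_congr rfl fun a' _ => ?_
  rw [← Finset.mul_sum]
  congr 1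
  have : ∀ b, (∀ s : Fin T, (s : ℕ) < t + 1 → φ.apply y p a' s = Function.update a t b s) ↔
      φ.apply y p a' t = b ∧ ∀ s : Fin T, (s : ℕ) < t → φ.apply y p a' s = a s := by
    intro b
    constructor
    · intro h
      refine ⟨by simpa using h t (by simp), fun s hs => ?_⟩
      rw [h s (by omega), Function.update_of_ne (by rintro rfl; omega)]
    · rintro ⟨h, h'⟩ s hs
      by_cases hst : s = t
      · subst hst; simpa using h
      · rw [Function.update_of_ne hst]
        exact h' s (by have : (s : ℕ) ≠ t := fun h => hst (Fin.ext h); omega)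
  simp only [this, ite_and]
  simp

theorem AgentAlgorithm.measurable_relabelledPrefix (L : AgentAlgorithm Y A T)
    (φ : Relabelling Y A T) (n : ℕ) (y : Fin T → Y) (r a : Fin T → A) :
    Measurable fun p => L.relabelledPrefix φ n y p r a := by
  refine Finset.measurable_sum _ fun a' _ => (L.measurable_prob y r a').mul ?_
  refine Measurable.ite ?_ measurable_const measurable_const
  rw [Set.ofPred_forall]
  refine MeasurableSet.iInter fun s => MeasurableSet.imp (MeasurableSet.const _) ?_
  exact (φ.measurableSet_map s (before y s) (a' s) (a s)).preimage (measurable_pi_apply s)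

open Classical in
theorem measurable_ite_div {α : Type} [MeasurableSpace α] (c : ENNReal) {f g : α → ENNReal}
    (hf : Measurable f) (hg : Measurable g) :
    Measurable fun x => if f x = 0 then c else g x / f x :=
  Measurable.ite (hf (measurableSet_singleton 0)) measurable_const (hg.div hf)

variable [Nonempty Y] [Nonempty A]

open Classical in
/-- The algorithm whose action sequence is distributed as the relabelled action sequence of `L`:
each action is drawn from its conditional distribution given the earlier relabelled actions. -/
def AgentAlgorithm.relabel (L : AgentAlgorithm Y A T) (φ : Relabelling Y A T) :
    AgentAlgorithm Y A T where
  act t y a r p :=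
    let y' : Fin T → Y := extend (Classical.arbitrary Y) y
    let p' : Fin T → unitInterval := extend 0 p
    let r' : Fin T → A := extend (Classical.arbitrary A) r
    let a' : Fin T → A := extend (Classical.arbitrary A) a
    if h : L.relabelledPrefix φ t y' p' r' a' = 0 then PMF.pure (Classical.arbitrary A)
    else PMF.ofFintype (fun b => L.relabelledPrefix φ (t + 1) y' p' r' (Function.update a' t b) /
        L.relabelledPrefix φ t y' p' r' a') (by
      simp_rw [div_eq_mul_inv]
      rw [← Finset.sum_mul, L.sum_relabelledPrefix_update]
      exact ENNReal.mul_inv_cancel h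
        (ne_top_of_le_ne_top ENNReal.one_ne_top (L.relabelledPrefix_le_one ..)))
  measurable_act t y a r b := by
    have hm : ∀ n a', Measurable fun p : Fin ((t : ℕ) + 1) → unitInterval =>
        L.relabelledPrefix φ n (extend (Classical.arbitrary Y) y) (extend 0 p)
          (extend (Classical.arbitrary A) r) a' := fun n a' =>
      (L.measurable_relabelledPrefix φ n _ _ a').comp (measurable_extend 0)
    convert measurable_ite_div (PMF.pure (Classical.arbitrary A) b)
      (hm t (extend (Classical.arbitrary A) a))
      (hm (t + 1) (Function.update (extend (Classical.arbitrary A) a) t b)) using 2 with p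
    simp only
    split_ifs <;> rfl

theorem AgentAlgorithm.stepProb_relabel (L : AgentAlgorithm Y A T) (φ : Relabelling Y A T)
    (y : Fin T → Y) (p : Fin T → unitInterval) (r a : Fin T → A) (t : Fin T)
    (h : L.relabelledPrefix φ t y p r a ≠ 0) :
    (L.relabel φ).stepProb y p r a t =
      L.relabelledPrefix φ (t + 1) y p r a / L.relabelledPrefix φ t y p r a := by
  have h1 : L.relabelledPrefix φ t (extend (Classical.arbitrary Y) (before y t))
      (extend 0 (upTo p t)) (extend (Classical.arbitrary A) (upTo r t))
      (extend (Classical.arbitrary A) (before a t)) = L.relabelledPrefix φ t y p r a :=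
    L.relabelledPrefix_congr φ t.isLt.le
      (fun s hs => extend_before _ _ (Fin.lt_def.2 (by omega)))
      (fun s hs => extend_upTo _ _ (Fin.le_def.2 (by omega)))
      (fun s hs => extend_upTo _ _ (Fin.le_def.2 (by omega)))
      (fun s hs => extend_before _ _ (Fin.lt_def.2 (by omega)))
  have h2 : L.relabelledPrefix φ (t + 1) (extend (Classical.arbitrary Y) (before y t))
      (extend 0 (upTo p t)) (extend (Classical.arbitrary A) (upTo r t))
      (Function.update (extend (Classical.arbitrary A) (before a t)) t (a t)) =
        L.relabelledPrefix φ (t + 1) y p r a := by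
    refine L.relabelledPrefix_congr φ t.isLt
      (fun s hs => extend_before _ _ (Fin.lt_def.2 (by omega)))
      (fun s hs => extend_upTo _ _ (Fin.le_def.2 (by omega)))
      (fun s hs => extend_upTo _ _ (Fin.le_def.2 (by omega))) fun s hs => ?_
    by_cases hst : s = t
    · subst hst; simp
    · rw [Function.update_of_ne hst, extend_before]
      exact lt_of_le_of_ne (Fin.le_def.2 (by omega)) hst
  simp only [stepProb, relabel]
  rw [dif_neg (by rwa [h1]), PMF.ofFintype_apply, h1, h2]

/-- The conditional probabilities telescope. -/
theorem AgentAlgorithm.prob_relabel (L : AgentAlgorithm Y A T) (φ : Relabelling Y A T)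
    (y : Fin T → Y) (p : Fin T → unitInterval) (r a : Fin T → A) :
    (L.relabel φ).prob y p r a = ∑ a', if φ.apply y p a' = a then L.prob y p r a' else 0 := by
  have key : ∀ n ≤ T, ∏ k ∈ Finset.range n, (if h : k < T then
      (L.relabel φ).stepProb y p r a ⟨k, h⟩ else 1) = L.relabelledPrefix φ n y p r a := by
    intro n
    induction n with
    | zero => simp [L.relabelledPrefix_zero]
    | succ n ih =>
      intro hn
      rw [Finset.prod_range_succ, ih (by omega), dif_pos (by omega)]
      -- A null prefix has only null continuations, so the default action in `relabel` is
      -- irrelevant.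
      by_cases h : L.relabelledPrefix φ n y p r a = 0
      · rw [h, zero_mul, eq_comm, ← nonpos_iff_eq_zero, ← h]
        exact L.relabelledPrefix_anti ..
      · rw [L.stepProb_relabel φ y p r a ⟨n, by omega⟩ h]
        exact ENNReal.mul_div_cancel h
          (ne_top_of_le_ne_top ENNReal.one_ne_top (L.relabelledPrefix_le_one ..))
  have := key T le_rfl
  rw [Finset.prod_range] at this
  simp only [Fin.is_lt, dite_true, Fin.eta] at this
  rw [prob, this, relabelledPrefix]
  refine Finset.sum_congr rfl fun a' _ => ?_
  simp [funext_iff]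

theorem AgentAlgorithm.actionProb_relabel (L : AgentAlgorithm Y A T) (φ : Relabelling Y A T)
    (y : Fin T → Y) (p : Fin T → unitInterval) (r a : Fin T → A) :
    (L.relabel φ).actionProb y p r a =
      ∑ a', if φ.apply y p a' = a then L.actionProb y p r a' else 0 := by
  rw [← toReal_prob, prob_relabel, ENNReal.toReal_sum]
  · refine Finset.sum_congr rfl fun a' _ => ?_
    split_ifs <;> simp [toReal_prob]
  · intro a' _
    split_ifs
    · exact ne_top_of_le_ne_top ENNReal.one_ne_top (L.prob_le_one ..)
    · simp

theorem AgentAlgorithm.expect_relabel (L : AgentAlgorithm Y A T) (φ : Relabelling Y A T)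
    (y : Fin T → Y) (p : Fin T → unitInterval) (r : Fin T → A) (f : (Fin T → A) → ℝ) :
    (L.relabel φ).expect y p r f = L.expect y p r fun a => f (φ.apply y p a) := by
  simp only [expect, actionProb_relabel, Finset.sum_mul]
  rw [Finset.sum_comm]
  simp

end Relabel

/-! ### Expectations and marginals of the Agent's play. -/

section Expectation

variable {Y A : Type} {T : ℕ}

theorem AgentAlgorithm.actionProb_nonneg (L : AgentAlgorithm Y A T) (y : Fin T → Y)
    (p : Fin T → unitInterval) (r a : Fin T → A) : 0 ≤ L.actionProb y p r a :=
  Finset.prod_nonneg fun _ _ => ENNReal.toReal_nonneg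

variable [Fintype A]

theorem AgentAlgorithm.expect_mono (L : AgentAlgorithm Y A T) {y : Fin T → Y}
    {p : Fin T → unitInterval} {r : Fin T → A} {f g : (Fin T → A) → ℝ} (h : ∀ a, f a ≤ g a) :
    L.expect y p r f ≤ L.expect y p r g :=
  Finset.sum_le_sum fun a _ => mul_le_mul_of_nonneg_left (h a) (L.actionProb_nonneg ..)

variable [DecidableEq A] [Nonempty A]

theorem AgentAlgorithm.sum_actionProb (L : AgentAlgorithm Y A T) (y : Fin T → Y)
    (p : Fin T → unitInterval) (r : Fin T → A) : ∑ a, L.actionProb y p r a = 1 := by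
  simp_rw [← toReal_prob]
  rw [← ENNReal.toReal_sum fun a _ => ne_top_of_le_ne_top ENNReal.one_ne_top (L.prob_le_one ..),
    L.sum_prob, ENNReal.toReal_one]

theorem AgentAlgorithm.expect_const (L : AgentAlgorithm Y A T) (y : Fin T → Y)
    (p : Fin T → unitInterval) (r : Fin T → A) (c : ℝ) : L.expect y p r (fun _ => c) = c := by
  rw [expect, ← Finset.sum_mul, L.sum_actionProb, one_mul]

theorem AgentAlgorithm.expect_add_const (L : AgentAlgorithm Y A T) (y : Fin T → Y)
    (p : Fin T → unitInterval) (r : Fin T → A) (f : (Fin T → A) → ℝ) (c : ℝ) :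
    L.expect y p r (fun a => f a + c) = L.expect y p r f + c := by
  conv_rhs => rw [← L.expect_const y p r c]
  simp only [expect, mul_add, Finset.sum_add_distrib]

/-- The probability that the Agent plays `b` at round `t`. -/
def AgentAlgorithm.marginal (L : AgentAlgorithm Y A T) (y : Fin T → Y) (p : Fin T → unitInterval)
    (r : Fin T → A) (t : Fin T) (b : A) : ℝ :=
  L.expect y p r fun a => if a t = b then 1 else 0

theorem AgentAlgorithm.marginal_nonneg (L : AgentAlgorithm Y A T) (y : Fin T → Y)
    (p : Fin T → unitInterval) (r : Fin T → A) (t : Fin T) (b : A) : 0 ≤ L.marginal y p r t b :=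
  (L.expect_const y p r 0).symm.le.trans (L.expect_mono fun a => by split_ifs <;> simp)

theorem AgentAlgorithm.marginal_le_one (L : AgentAlgorithm Y A T) (y : Fin T → Y)
    (p : Fin T → unitInterval) (r : Fin T → A) (t : Fin T) (b : A) : L.marginal y p r t b ≤ 1 :=
  (L.expect_mono fun a => by split_ifs <;> simp).trans (L.expect_const y p r 1).le

/-- Neither the state of round `t` nor anything later affects the action there; this is the
independence behind the averaging over states. -/
theorem AgentAlgorithm.marginal_congr (L : AgentAlgorithm Y A T) {y y' : Fin T → Y}
    {p p' : Fin T → unitInterval} {r r' : Fin T → A} {t : Fin T} (hy : ∀ s < t, y s = y' s)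
    (hp : ∀ s ≤ t, p s = p' s) (hr : ∀ s ≤ t, r s = r' s) (b : A) :
    L.marginal y p r t b = L.marginal y' p' r' t b := by
  have key : ∀ (y : Fin T → Y) (p : Fin T → unitInterval) (r : Fin T → A), L.marginal y p r t b =
      (∑ a, L.prob y p r a * if a t = b then 1 else 0).toReal := fun y p r => by
    rw [ENNReal.toReal_sum]
    · refine Finset.sum_congr rfl fun a _ => ?_
      rw [← toReal_prob, ENNReal.toReal_mul]
      congr 1
      simp only
      split_ifs <;> simp
    · intro a _
      refine ENNReal.mul_ne_top (ne_top_of_le_ne_top ENNReal.one_ne_top (L.prob_le_one ..)) ?_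
      split_ifs <;> simp
  rw [key, key, L.sum_prob_mul_congr (n := t + 1) t.isLt]
  · intro a a' h
    simp only [h t (Nat.lt_succ_self _)]
  · exact fun s hs => hy s (Fin.lt_def.2 (by omega))
  · exact fun s hs => hp s (Fin.le_def.2 (by omega))
  · exact fun s hs => hr s (Fin.le_def.2 (by omega))

theorem AgentAlgorithm.expect_affine (L : AgentAlgorithm Y A T) (y : Fin T → Y)
    (p : Fin T → unitInterval) (r : Fin T → A) (c : ℝ) (f g : Fin T → ℝ) (b : A) :
    L.expect y p r (fun a => c * ∑ t, (f t + g t * if a t = b then 1 else 0)) =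
      c * ∑ t, (f t + g t * L.marginal y p r t b) := by
  have h : ∀ t, f t + g t * L.marginal y p r t b =
      ∑ a, L.actionProb y p r a * (f t + g t * if a t = b then 1 else 0) := fun t => by
    simp only [mul_add, Finset.sum_add_distrib, ← Finset.sum_mul, L.sum_actionProb, one_mul,
      marginal, expect, Finset.mul_sum]
    congr 1
    exact Finset.sum_congr rfl fun a _ => by ring
  simp only [h, expect]
  rw [Finset.sum_comm, Finset.mul_sum]
  refine Finset.sum_congr rfl fun a _ => ?_
  rw [← Finset.mul_sum]; ring

end Expectation

/-! ### Measurability and integrability in the mechanism's randomness. -/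

section Measurability

variable {Y A O : Type} {T : ℕ} {Ω : Type} [MeasurableSpace Ω]

theorem AgentAlgorithm.measurable_actionProb [Finite A] (L : AgentAlgorithm Y A T) (y : Fin T → Y)
    (a : Fin T → A) {p : Ω → Fin T → unitInterval} {r : Ω → Fin T → A}
    (hp : ∀ t, Measurable fun ω => p ω t) (hr : ∀ t b, MeasurableSet {ω | r ω t = b}) :
    Measurable fun ω => L.actionProb y (p ω) (r ω) a := by
  classical
  have := Fintype.ofFinite A
  have h : ∀ r', MeasurableSet {ω | r ω = r'} := fun r' => by
    simp only [funext_iff]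
    rw [Set.ofPred_forall]
    exact MeasurableSet.iInter fun t => hr t (r' t)
  -- Recommendations take finitely many values, so the dependence on them is split into cases.
  have hsum : (fun ω => L.actionProb y (p ω) (r ω) a) =
      fun ω => ∑ r', if r ω = r' then (L.prob y (p ω) r' a).toReal else 0 := by
    funext ω
    simp [L.toReal_prob]
  rw [hsum]
  exact Finset.measurable_sum _ fun r' _ => Measurable.ite (h r')
    ((L.measurable_prob y r' a).comp (measurable_pi_lambda _ hp)).ennreal_toReal measurable_const

variable [Fintype A]

theorem measurable_principalPayoff (S : LinearContractSetting Y A O) (L : AgentAlgorithm Y A T)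
    (y : Fin T → Y) {p : Ω → Fin T → unitInterval} {r : Ω → Fin T → A}
    (hp : ∀ t, Measurable fun ω => p ω t) (hr : ∀ t b, MeasurableSet {ω | r ω t = b}) :
    Measurable fun ω => principalPayoff S L y (p ω) (r ω) :=
  Finset.measurable_sum _ fun a _ => (L.measurable_actionProb y a hp hr).mul
    (measurable_const.mul (Finset.measurable_sum _ fun t _ =>
      (measurable_const.sub (measurable_subtype_coe.comp (hp t))).mul_const _))

theorem principalPayoff_mem_Icc [DecidableEq A] [Nonempty A] (S : LinearContractSetting Y A O)
    (L : AgentAlgorithm Y A T) (y : Fin T → Y) (p : Fin T → unitInterval) (r : Fin T → A) :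
    principalPayoff S L y p r ∈ Set.Icc (0 : ℝ) 1 := by
  have h : ∀ (a : Fin T → A) (t : Fin T), S.principalUtility (a t) (p t) (y t) ∈ Set.Icc (0 : ℝ) 1 := fun a t => by
    obtain ⟨h0, h1⟩ := (p t).2
    obtain ⟨g0, g1⟩ := S.value_mem (S.outcome (a t) (y t))
    exact ⟨mul_nonneg (by linarith) g0, mul_le_one₀ (by linarith) g0 g1⟩
  constructor
  · refine (L.expect_const y p r 0).symm.le.trans (L.expect_mono fun a => ?_)
    exact mul_nonneg (by positivity) (Finset.sum_nonneg fun t _ => (h a t).1)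
  · refine (L.expect_mono fun a => ?_).trans (L.expect_const y p r 1).le
    calc (1 / (T : ℝ)) * ∑ t, S.principalUtility (a t) (p t) (y t)
        ≤ (1 / (T : ℝ)) * ∑ _t : Fin T, (1 : ℝ) := by gcongr with t; exact (h a t).2
      _ ≤ 1 := by simpa using inv_mul_le_one

variable [Fintype Y]

/-- The gain from the constant policy `p₀` over the mechanism, in one realization. -/
def benchmarkGain (S : LinearContractSetting Y A O) (br : BestResponseRule S)
    (σ : Mechanism Y A T) (L : AgentAlgorithm Y A T) (y : Fin T → Y) (p₀ : unitInterval)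
    (ω : σ.Ω) : ℝ :=
  principalPayoff S L y (fun _ => p₀) (σ.constRecommendations br p₀ y ω)
    - principalPayoff S L y (σ.policies y ω) (σ.recommendations y ω)

variable (S : LinearContractSetting Y A O) (br : BestResponseRule S)
    (σ : Mechanism Y A T) (L : AgentAlgorithm Y A T) (y : Fin T → Y)

theorem measurable_benchmarkGain (p₀ : unitInterval) :
    Measurable (benchmarkGain S br σ L y p₀) :=
  (measurable_principalPayoff S L y (fun _ => measurable_const) fun t b =>
      (br.measurable_act p₀ b).preimage (σ.measurable_forecast t (before y t))).sub
    (measurable_principalPayoff S L y (fun t => σ.measurable_policy t (before y t)) fun t b =>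
      σ.measurable_recommendation t (before y t) b)

variable [DecidableEq A] [Nonempty A]

theorem abs_benchmarkGain_le (p₀ : unitInterval) (ω : σ.Ω) :
    |benchmarkGain S br σ L y p₀ ω| ≤ 1 := by
  have h1 := principalPayoff_mem_Icc S L y (fun _ => p₀) (σ.constRecommendations br p₀ y ω)
  have h2 := principalPayoff_mem_Icc S L y (σ.policies y ω) (σ.recommendations y ω)
  rw [abs_le, benchmarkGain]
  constructor <;> linarith [h1.1, h1.2, h2.1, h2.2]

theorem integrable_benchmarkGain (p₀ : unitInterval) :
    Integrable (benchmarkGain S br σ L y p₀) σ.μ :=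
  Integrable.of_bound (measurable_benchmarkGain S br σ L y p₀).aestronglyMeasurable 1
    (ae_of_all _ (abs_benchmarkGain_le S br σ L y p₀))

/-- A benchmark fixed before the realization already bounds policy regret from below. -/
theorem integral_benchmarkGain_le_policyRegret {p₀ : unitInterval} (hp₀ : p₀ ∈ S.benchmarks) :
    ∫ ω, benchmarkGain S br σ L y p₀ ω ∂σ.μ ≤ policyRegret S br σ L y := by
  refine integral_mono (integrable_benchmarkGain S br σ L y p₀) ?_ fun ω =>
    Finset.le_sup' (fun p₀ => benchmarkGain S br σ L y p₀ ω) hp₀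
  have hm : Measurable (S.benchmarks.sup' S.benchmarks_nonempty
      fun p₀ => benchmarkGain S br σ L y p₀) :=
    Finset.measurable_sup' _ fun p₀ _ => measurable_benchmarkGain S br σ L y p₀
  refine Integrable.of_bound ?_ 1 (ae_of_all _ fun ω => ?_)
  · convert hm.aestronglyMeasurable using 2 with ω
    rw [Finset.sup'_apply]; rfl
  · rw [Real.norm_eq_abs, abs_le]
    constructor
    · exact (abs_le.1 (abs_benchmarkGain_le S br σ L y p₀ ω)).1.trans
        (Finset.le_sup' (fun p₀ => benchmarkGain S br σ L y p₀ ω) hp₀)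
    · exact Finset.sup'_le _ _ fun p₁ _ => (abs_le.1 (abs_benchmarkGain_le S br σ L y p₁ ω)).2

end Measurability

/-! ### Averaging over uniform states. -/

section Averaging

/-- On average over uniformly random states, the state of round `t` is independent of anything
that does not depend on it. -/
theorem sum_mul_ite_eq_half {T : ℕ} (t : Fin T) {f : (Fin T → Fin 2) → ℝ}
    (hf : ∀ y b, f (Function.update y t b) = f y) :
    ∑ y, f y * (if y t = 1 then 1 else 0) = ∑ y, f y / 2 := by
  -- Flipping the state of round `t` exchanges the two sums and preserves `f`.
  have hswap : ∑ y, f y * (if y t = 1 then 1 else 0) = ∑ y, f y * (if y t = 0 then 1 else 0) := by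
    have hinv : Function.Involutive fun y : Fin T → Fin 2 => Function.update y t (1 - y t) :=
      fun y => by simp
    refine Fintype.sum_equiv hinv.toPerm _ _ fun y => ?_
    have : (1 - y t = 0) ↔ y t = 1 := by rw [sub_eq_zero, eq_comm]
    simp [hf, this]
  have hadd : ∑ y, f y * (if y t = 1 then 1 else 0) + ∑ y, f y * (if y t = 0 then 1 else 0) =
      ∑ y, f y := by
    rw [← Finset.sum_add_distrib]
    refine Finset.sum_congr rfl fun y _ => ?_
    rcases Fin.exists_fin_two.1 ⟨y t, rfl⟩ with h | h <;> simp [h]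
  rw [← Finset.sum_div]
  linarith

end Averaging

/-- The action `1` succeeds in the state `1` only, and costs `1/4`; the action `0` is free and
never succeeds. -/
def effortSetting : LinearContractSetting (Fin 2) (Fin 2) (Fin 2) where
  outcome a y := if a = 1 ∧ y = 1 then 1 else 0
  value o := if o = 1 then 1 else 0
  value_mem o := by split_ifs <;> simp
  cost a := if a = 1 then 1 / 4 else 0
  cost_mem a := by split_ifs <;> norm_num
  cost_injective a b h := by
    fin_cases a <;> fin_cases b <;> simp_all
  benchmarks := {⟨1 / 3, by norm_num, by norm_num⟩, ⟨3 / 8, by norm_num, by norm_num⟩}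
  benchmarks_nonempty := Finset.insert_nonempty _ _

theorem effortSetting_agentUtility (a : Fin 2) (p : unitInterval) (y : Fin 2) :
    effortSetting.agentUtility a p y =
      if a = 1 then (p : ℝ) * (if y = 1 then 1 else 0) - 1 / 4 else 0 := by
  by_cases ha : a = 1 <;> by_cases hy : y = 1 <;>
    simp [LinearContractSetting.agentUtility, effortSetting, ha, hy]

theorem effortSetting_principalUtility (a : Fin 2) (p : unitInterval) (y : Fin 2) :
    effortSetting.principalUtility a p y =
      (1 - (p : ℝ)) * (if a = 1 then 1 else 0) * (if y = 1 then 1 else 0) := by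
  by_cases ha : a = 1 <;> by_cases hy : y = 1 <;>
    simp [LinearContractSetting.principalUtility, effortSetting, ha, hy]

theorem abs_agentUtility_le_one (a : Fin 2) (p : unitInterval) (y : Fin 2) :
    |effortSetting.agentUtility a p y| ≤ 1 := by
  obtain ⟨h0, h1⟩ := p.2
  rw [effortSetting_agentUtility, abs_le]
  split_ifs <;> constructor <;> linarith

/-! ### Informed effort: its price in swap regret and its effect on the Principal. -/

variable {T : ℕ}

/-- As long as the states agree with `ybar`, exert effort whenever the policy is `q` and
the state of the round is going to be `1`. -/
def informedEffort (q : unitInterval) (ybar : Fin T → Fin 2) : Relabelling (Fin 2) (Fin 2) T where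
  map t h p a := if p = q then (if ybar t = 1 ∧ h = before ybar t then 1 else a) else a
  measurableSet_map _ _ _ b :=
    (Measurable.ite (measurableSet_singleton q) measurable_const measurable_const)
      (measurableSet_singleton b)

/-- The summand of the swap regret with modification rule `h`. -/
def deviationGain (h : unitInterval → Fin 2 → Fin 2 → Fin 2) (y : Fin T → Fin 2)
    (p : Fin T → unitInterval) (r a : Fin T → Fin 2) (t : Fin T) : ℝ :=
  effortSetting.agentUtility (h (p t) (r t) (a t)) (p t) (y t)
    - effortSetting.agentUtility (a t) (p t) (y t)

theorem deviationGain_le_two (h : unitInterval → Fin 2 → Fin 2 → Fin 2) (y : Fin T → Fin 2)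
    (p : Fin T → unitInterval) (r a : Fin T → Fin 2) (t : Fin T) :
    deviationGain h y p r a t ≤ 2 := by
  have h1 := (abs_le.1 (abs_agentUtility_le_one (h (p t) (r t) (a t)) (p t) (y t))).2
  have h2 := (abs_le.1 (abs_agentUtility_le_one (a t) (p t) (y t))).1
  unfold deviationGain
  linarith

theorem bddAbove_range_deviationGain (y : Fin T → Fin 2) (p : Fin T → unitInterval)
    (r a : Fin T → Fin 2) :
    BddAbove (Set.range fun h : unitInterval → Fin 2 → Fin 2 → Fin 2 =>
      (1 / (T : ℝ)) * ∑ t, deviationGain h y p r a t) := by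
  refine ⟨(1 / (T : ℝ)) * ∑ _t : Fin T, 2, ?_⟩
  rintro _ ⟨h, rfl⟩
  dsimp only
  gcongr with t
  exact deviationGain_le_two ..

/-- Informed effort lowers the gain from each deviation, except possibly in the round in which the
states depart from `ybar`. -/
theorem deviationGain_informedEffort_le {q : unitInterval} (hq : 1 / 4 ≤ (q : ℝ))
    (ybar : Fin T → Fin 2) (h : unitInterval → Fin 2 → Fin 2 → Fin 2) (y : Fin T → Fin 2)
    (p : Fin T → unitInterval) (r a : Fin T → Fin 2) (t : Fin T) :
    deviationGain h y p r ((informedEffort q ybar).apply y p a) t ≤ deviationGain h y p r a t +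
      if before y t = before ybar t ∧ y t ≠ ybar t then 2 else 0 := by
  have hp1 := (p t).2.2
  by_cases hc : (informedEffort q ybar).apply y p a t = a t
  · simp only [deviationGain, hc]
    split_ifs <;> linarith
  -- The action changes only if the policy is `q`, the past follows `ybar` and `ybar` announces
  -- state 1; it then changes from 0 to 1.
  have hcond : p t = q ∧ ybar t = 1 ∧ before y t = before ybar t := by
    by_contra hcond
    refine hc ?_
    simp only [Relabelling.apply, informedEffort]
    split_ifs <;> simp_all
  have happ : (informedEffort q ybar).apply y p a t = 1 := by
    simp [Relabelling.apply, informedEffort, hcond]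
  have ha : a t ≠ 1 := fun ha => hc (happ.trans ha.symm)
  have hq' : 1 / 4 ≤ (p t : ℝ) := by rwa [hcond.1]
  simp only [deviationGain, happ, effortSetting_agentUtility, hcond.2.1, hcond.2.2, if_neg ha,
    if_true, true_and]
  generalize h (p t) (r t) 1 = b
  generalize h (p t) (r t) (a t) = b'
  -- If the announcement is right, effort earns `p t - 1/4 ≥ 0`: the new gain is at most 0 and the
  -- old one at least 0. Otherwise this is the departure round, and the slack 2 suffices.
  by_cases hy : y t = 1
  · rw [if_pos hy, if_neg (not_not.2 hy)]
    split_ifs <;> linarith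
  · rw [if_neg hy, if_pos hy]
    split_ifs <;> linarith

/-- A departure round is the first disagreement with `ybar`, hence unique. -/
theorem sum_departure_le (y ybar : Fin T → Fin 2) :
    ∑ t, (if before y t = before ybar t ∧ y t ≠ ybar t then (2 : ℝ) else 0) ≤ 2 := by
  rw [← Finset.sum_filter, Finset.sum_const, nsmul_eq_mul]
  have hlt : ∀ s t : Fin T, before y t = before ybar t → y s ≠ ybar s → t ≤ s := by
    intro s t h hs
    by_contra! hlt
    exact hs (congrFun h ⟨s, hlt⟩)
  have : (Finset.univ.filter fun t => before y t = before ybar t ∧ y t ≠ ybar t).card ≤ 1 := by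
    rw [Finset.card_le_one]
    intro s hs t ht
    simp only [Finset.mem_filter, Finset.mem_univ, true_and] at hs ht
    exact le_antisymm (hlt _ _ hs.1 ht.2) (hlt _ _ ht.1 hs.2)
  have : ((Finset.univ.filter fun t => before y t = before ybar t ∧ y t ≠ ybar t).card : ℝ) ≤ 1 :=
    by exact_mod_cast this
  linarith

/-- The bound holds for each hidden action sequence and each modification rule, so it passes to
suprema and expectations. -/
theorem swapRegret_relabel_informedEffort_le {q : unitInterval} (hq : 1 / 4 ≤ (q : ℝ))
    (L : AgentAlgorithm (Fin 2) (Fin 2) T) (ybar y : Fin T → Fin 2) (p : Fin T → unitInterval)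
    (r : Fin T → Fin 2) :
    swapRegret effortSetting (L.relabel (informedEffort q ybar)) y p r ≤
      swapRegret effortSetting L y p r + 2 / T := by
  unfold swapRegret
  rw [L.expect_relabel, ← L.expect_add_const]
  refine L.expect_mono fun a => ciSup_le fun h => ?_
  calc (1 / (T : ℝ)) * ∑ t, deviationGain h y p r ((informedEffort q ybar).apply y p a) t
      ≤ (1 / (T : ℝ)) * ∑ t, (deviationGain h y p r a t +
          if before y t = before ybar t ∧ y t ≠ ybar t then 2 else 0) := by
        gcongr with t
        exact deviationGain_informedEffort_le hq ..
    _ ≤ (1 / (T : ℝ)) * (∑ t, deviationGain h y p r a t + 2) := by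
        rw [Finset.sum_add_distrib]
        gcongr
        exact sum_departure_le y ybar
    _ = (1 / (T : ℝ)) * ∑ t, deviationGain h y p r a t + 2 / T := by ring
    _ ≤ _ := by
        gcongr
        exact le_ciSup (bddAbove_range_deviationGain y p r a) h

/-- The swap regret is at least the gain from giving up effort under all policies below `1/2`. -/
theorem le_swapRegret (L : AgentAlgorithm (Fin 2) (Fin 2) T) (y : Fin T → Fin 2)
    (p : Fin T → unitInterval) (r : Fin T → Fin 2) :
    (1 / (T : ℝ)) * ∑ t, (if (p t : ℝ) < 1 / 2 then 1 / 4 - (p t : ℝ) * (if y t = 1 then 1 else 0)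
      else 0) * L.marginal y p r t 1 ≤ swapRegret effortSetting L y p r := by
  have := L.expect_affine y p r (1 / (T : ℝ)) (fun _ => 0) (fun t => if (p t : ℝ) < 1 / 2 then
    1 / 4 - (p t : ℝ) * (if y t = 1 then 1 else 0) else 0) 1
  simp only [zero_add] at this
  rw [← this]
  refine L.expect_mono fun a => ?_
  -- Against a fair state, effort earns `p/2 - 1/4`, which is negative exactly when `p < 1/2`.
  refine le_trans (le_of_eq ?_) (le_ciSup (bddAbove_range_deviationGain y p r a)
    fun p _ a => if (p : ℝ) < 1 / 2 then 0 else a)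
  congr 1
  refine Finset.sum_congr rfl fun t _ => ?_
  simp only [deviationGain, effortSetting_agentUtility]
  by_cases hp : (p t : ℝ) < 1 / 2
  · rw [if_pos hp, if_pos hp]
    by_cases ha : a t = 1 <;> simp [ha]
  · rw [if_neg hp, if_neg hp]
    simp

/-- On the foreseen sequence every round of state 1 under `q` succeeds; under other policies the
action is that of `L`. -/
theorem principalPayoff_relabel_informedEffort (q : unitInterval)
    (L : AgentAlgorithm (Fin 2) (Fin 2) T) (y : Fin T → Fin 2) (p : Fin T → unitInterval)
    (r : Fin T → Fin 2) :
    principalPayoff effortSetting (L.relabel (informedEffort q y)) y p r =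
      (1 / (T : ℝ)) * ∑ t, (if p t = q then 1 - (q : ℝ) else (1 - (p t : ℝ)) * L.marginal y p r t 1)
        * (if y t = 1 then 1 else 0) := by
  unfold principalPayoff
  rw [L.expect_relabel]
  trans L.expect y p r (fun a => (1 / (T : ℝ)) * ∑ t,
    ((if p t = q then (1 - (q : ℝ)) * (if y t = 1 then 1 else 0) else 0) +
      (if p t = q then 0 else (1 - (p t : ℝ)) * (if y t = 1 then 1 else 0)) *
        if a t = 1 then 1 else 0))
  · congr 1
    funext a
    congr 1
    refine Finset.sum_congr rfl fun t _ => ?_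
    simp only [effortSetting_principalUtility, Relabelling.apply, informedEffort]
    by_cases hp : p t = q <;> by_cases hy : y t = 1 <;> by_cases ha : a t = 1 <;>
      simp [hp, hy, ha]
  · rw [L.expect_affine]
    congr 1
    refine Finset.sum_congr rfl fun t _ => ?_
    by_cases hp : p t = q <;> by_cases hy : y t = 1 <;> simp [hp, hy]

/-- For `p < 1/2` the terms in `p` cancel and leave `(1-q)/2 - w/4`; for `p ≥ 1/2`, `(1-p)w/2 ≤
1/4`. Since `(1-q)/2 ≥ 5/16`, both cases give 1/16. -/
theorem half_gain_add_regret_ge {p q w : ℝ} (hp : p ∈ Set.Icc (0 : ℝ) 1)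
    (hw : w ∈ Set.Icc (0 : ℝ) 1) (hq : q ≤ 3 / 8) :
    1 / 16 ≤ ((1 - q) - (1 - p) * w) / 2 + (if p < 1 / 2 then 1 / 4 - p / 2 else 0) * w := by
  obtain ⟨hp0, hp1⟩ := hp
  obtain ⟨hw0, hw1⟩ := hw
  split_ifs with h
  · nlinarith
  · nlinarith

/-- In each realization of the mechanism, summed over all state sequences: the gain from the
constant policy `q`, plus the swap regret, is at least of the order of the number of rounds in
which the mechanism does not play `q`. -/
theorem sum_benchmarkGain_add_swapRegret_ge (br : BestResponseRule effortSetting)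
    (σ : Mechanism (Fin 2) (Fin 2) T) (L : AgentAlgorithm (Fin 2) (Fin 2) T) {q : unitInterval}
    (hq : (q : ℝ) ≤ 3 / 8) (ω : σ.Ω) :
    (1 / (T : ℝ)) * ∑ y, ∑ t, (if σ.policies y ω t = q then 0 else (1 / 16 : ℝ)) ≤
      ∑ y, (benchmarkGain effortSetting br σ (L.relabel (informedEffort q y)) y q ω +
        swapRegret effortSetting L y (σ.policies y ω) (σ.recommendations y ω)) := by
  set P : (Fin T → Fin 2) → Fin T → unitInterval := fun y => σ.policies y ω
  set w : (Fin T → Fin 2) → Fin T → ℝ := fun y t =>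
    L.marginal y (σ.policies y ω) (σ.recommendations y ω) t 1
  have hne : ∀ {t s : Fin T} {y : Fin T → Fin 2} {b : Fin 2}, s < t →
      Function.update y t b s = y s := fun h => Function.update_of_ne h.ne _ _
  have hP : ∀ (t s : Fin T), s ≤ t → ∀ y b, P (Function.update y t b) s = P y s := by
    intro t s hs y b
    simp only [P, Mechanism.policies]
    rw [before_congr fun u hu => hne (hu.trans_le hs)]
  have hw : ∀ (t : Fin T) y b, w (Function.update y t b) t = w y t := by
    intro t y b
    refine L.marginal_congr (fun s hs => hne hs) (fun s hs => hP t s hs y b) (fun s hs => ?_) 1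
    simp only [Mechanism.recommendations]
    rw [before_congr fun u hu => hne (hu.trans_le hs)]
  -- The coefficients `f`, `g`, `g'` at round `t` do not involve the state of that round, which
  -- enters only as the indicator of state 1.
  set f : (Fin T → Fin 2) → Fin T → ℝ := fun y t =>
    if P y t = q then 0 else (1 - (q : ℝ)) - (1 - (P y t : ℝ)) * w y t
  set g : (Fin T → Fin 2) → Fin T → ℝ := fun y t =>
    if (P y t : ℝ) < 1 / 2 then (P y t : ℝ) * w y t else 0
  set g' : (Fin T → Fin 2) → Fin T → ℝ := fun y t =>
    if (P y t : ℝ) < 1 / 2 then 1 / 4 * w y t else 0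
  have hgain : ∀ y, benchmarkGain effortSetting br σ (L.relabel (informedEffort q y)) y q ω =
      (1 / (T : ℝ)) * ∑ t, f y t * (if y t = 1 then 1 else 0) := by
    intro y
    rw [benchmarkGain, principalPayoff_relabel_informedEffort,
      principalPayoff_relabel_informedEffort, ← mul_sub, ← Finset.sum_sub_distrib]
    congr 1
    refine Finset.sum_congr rfl fun t _ => ?_
    simp only [f, if_true, ← sub_mul, P, w]
    by_cases h : σ.policies y ω t = q <;> simp [h]
  have hreg : ∀ y, (1 / (T : ℝ)) * ∑ t, (g' y t - g y t * (if y t = 1 then 1 else 0)) ≤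
      swapRegret effortSetting L y (σ.policies y ω) (σ.recommendations y ω) := by
    intro y
    refine le_trans (le_of_eq ?_) (le_swapRegret L y _ _)
    congr 1
    refine Finset.sum_congr rfl fun t _ => ?_
    simp only [g, g', P, w]
    split_ifs <;> ring
  have hfu : ∀ t y b, f (Function.update y t b) t = f y t := fun t y b => by
    simp only [f, hP t t le_rfl, hw]
  have hgu : ∀ t y b, g (Function.update y t b) t = g y t := fun t y b => by
    simp only [g, hP t t le_rfl, hw]
  calc (1 / (T : ℝ)) * ∑ y, ∑ t, (if σ.policies y ω t = q then 0 else (1 / 16 : ℝ))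
      ≤ (1 / (T : ℝ)) * ∑ y, ∑ t, (f y t / 2 + (g' y t - g y t / 2)) := by
        gcongr with y _ t
        have := half_gain_add_regret_ge (P y t).2
          ⟨L.marginal_nonneg y (σ.policies y ω) (σ.recommendations y ω) t 1,
            L.marginal_le_one y (σ.policies y ω) (σ.recommendations y ω) t 1⟩ hq
        have hw0 : 0 ≤ w y t := L.marginal_nonneg ..
        -- When the mechanism plays `q` the gain vanishes, and `q < 1/2` makes the averaged regret
        -- term nonnegative.
        by_cases hpq : P y t = q
        · have : (P y t : ℝ) < 1 / 2 := by rw [hpq]; linarith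
          simp only [f, g, g', if_pos hpq, if_pos this]
          rw [if_pos hpq]
          nlinarith
        · simp only [f, g, g', if_neg hpq]
          rw [if_neg hpq]
          refine this.trans (le_of_eq ?_)
          simp only [P, w]
          split_ifs <;> ring
    _ = ∑ y, ((1 / (T : ℝ)) * ∑ t, f y t * (if y t = 1 then 1 else 0) +
          (1 / (T : ℝ)) * ∑ t, (g' y t - g y t * (if y t = 1 then 1 else 0))) := by
        simp only [← mul_add, ← Finset.mul_sum]
        congr 1
        simp only [← Finset.sum_add_distrib]
        rw [Finset.sum_comm]
        conv_rhs => rw [Finset.sum_comm]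
        refine Finset.sum_congr rfl fun t _ => ?_
        simp only [Finset.sum_add_distrib, Finset.sum_sub_distrib]
        rw [sum_mul_ite_eq_half t (hfu t), sum_mul_ite_eq_half t (hgu t)]
    _ ≤ _ := Finset.sum_le_sum fun y _ => by
        rw [hgain]
        gcongr
        exact hreg y

/-- From an algorithm with swap regret at most `ε`, an informed one with nearly the same swap
regret against which the mechanism has policy regret bounded away from zero. -/
theorem exists_algorithm_policyRegret_ge (br : BestResponseRule effortSetting)
    (σ : Mechanism (Fin 2) (Fin 2) T) (L : AgentAlgorithm (Fin 2) (Fin 2) T) {ε : ℝ}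
    (hL : ∀ y, SwapRegretLE effortSetting br σ L y ε) :
    ∃ (L' : AgentAlgorithm (Fin 2) (Fin 2) T) (ybar : Fin T → Fin 2),
      (∀ y, SwapRegretLE effortSetting br σ L' y (ε + 2 / T)) ∧
        (0 < T → 1 / 32 - ε ≤ policyRegret effortSetting br σ L' ybar) := by
  set N : unitInterval → σ.Ω → ℝ := fun q ω =>
    (1 / (T : ℝ)) * ∑ y, ∑ t, (if σ.policies y ω t = q then 0 else (1 / 16 : ℝ)) with hN
  have hNint : ∀ q, Integrable (N q) σ.μ := fun q =>
    (integrable_finsetSum _ fun y _ => integrable_finsetSum _ fun t _ =>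
      Integrable.of_bound (Measurable.ite
        ((σ.measurable_policy t (before y t)) (measurableSet_singleton q))
        measurable_const measurable_const).aestronglyMeasurable (1 / 16)
        (ae_of_all _ fun ω => by split_ifs <;> norm_num)).const_mul _
  have hNsum : ∀ q q' : unitInterval, q ≠ q' → 0 < T → ∀ ω, (2 : ℝ) ^ T / 16 ≤ N q ω + N q' ω := by
    intro q q' hqq hT ω
    have hT' : (T : ℝ) ≠ 0 := by positivity
    calc (2 : ℝ) ^ T / 16 = (1 / (T : ℝ)) * ∑ _y : Fin T → Fin 2, ∑ _t : Fin T, (1 / 16 : ℝ) := by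
          simp; field_simp
      _ ≤ (1 / (T : ℝ)) * ∑ y : Fin T → Fin 2, ∑ t : Fin T,
          ((if σ.policies y ω t = q then 0 else (1 / 16 : ℝ)) +
            if σ.policies y ω t = q' then 0 else (1 / 16 : ℝ)) := by
          gcongr with y _ t
          by_cases h : σ.policies y ω t = q
          · rw [if_pos h, if_neg (h ▸ hqq)]; norm_num
          · rw [if_neg h]; split_ifs <;> norm_num
      _ = N q ω + N q' ω := by simp only [hN, Finset.sum_add_distrib, mul_add]
  -- The benchmark avoided more often in expectation; it may depend on `T` and the mechanism, but
  -- not on the realization.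
  obtain ⟨q, hqmem, hq1, hq2, hqN⟩ : ∃ q ∈ effortSetting.benchmarks, 1 / 4 ≤ (q : ℝ) ∧
      (q : ℝ) ≤ 3 / 8 ∧ (0 < T → (2 : ℝ) ^ T / 32 ≤ ∫ ω, N q ω ∂σ.μ) := by
    set q₁ : unitInterval := ⟨1 / 3, by norm_num, by norm_num⟩
    set q₂ : unitInterval := ⟨3 / 8, by norm_num, by norm_num⟩
    have hsum : 0 < T → (2 : ℝ) ^ T / 16 ≤ ∫ ω, N q₁ ω ∂σ.μ + ∫ ω, N q₂ ω ∂σ.μ := fun hT => by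
      rw [← integral_add (hNint _) (hNint _)]
      have hne : q₁ ≠ q₂ := fun h => by
        have := congrArg Subtype.val h
        norm_num [q₁, q₂] at this
      simpa using integral_mono (integrable_const ((2 : ℝ) ^ T / 16))
        ((hNint q₁).add (hNint q₂)) (hNsum q₁ q₂ hne hT)
    by_cases h : (2 : ℝ) ^ T / 32 ≤ ∫ ω, N q₁ ω ∂σ.μ
    · exact ⟨q₁, Finset.mem_insert_self _ _, by norm_num [q₁], by norm_num [q₁], fun _ => h⟩
    · refine ⟨q₂, Finset.mem_insert_of_mem (Finset.mem_singleton_self _), by norm_num [q₂],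
        by norm_num [q₂], fun hT => ?_⟩
      linarith [hsum hT]
  set G : (Fin T → Fin 2) → σ.Ω → ℝ := fun y =>
    benchmarkGain effortSetting br σ (L.relabel (informedEffort q y)) y q
  have hGint : ∀ y, Integrable (G y) σ.μ := fun y => integrable_benchmarkGain ..
  -- Only the regret bound for the deployed run is needed here, summed over all `2 ^ T` state
  -- sequences.
  have hae : ∀ᵐ ω ∂σ.μ, N q ω - 2 ^ T * ε ≤ ∑ y, G y ω := by
    filter_upwards [ae_all_iff.2 hL] with ω hω
    have h1 := sum_benchmarkGain_add_swapRegret_ge br σ L hq2 ω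
    rw [Finset.sum_add_distrib] at h1
    have h2 := Finset.sum_le_sum fun y (_ : y ∈ Finset.univ) => (hω y).1
    simp only [Finset.sum_const, Finset.card_univ, Fintype.card_pi_const, Fintype.card_fin,
      nsmul_eq_mul] at h2
    push_cast at h2
    linarith
  have hint : ∫ ω, N q ω ∂σ.μ - 2 ^ T * ε ≤ ∑ y, ∫ ω, G y ω ∂σ.μ := by
    rw [← integral_finsetSum _ fun y _ => hGint y]
    have := integral_mono_ae ((hNint q).sub (integrable_const (2 ^ T * ε)))
      (integrable_finsetSum Finset.univ fun y _ => hGint y) hae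
    rw [integral_sub' (hNint q) (integrable_const _)] at this
    simpa using this
  -- Some sequence reaches the average of the gains over all `2 ^ T` of them.
  obtain ⟨ybar, hybar⟩ : ∃ ybar : Fin T → Fin 2, 0 < T → 1 / 32 - ε ≤ ∫ ω, G ybar ω ∂σ.μ := by
    by_cases hT : 0 < T
    · by_contra! hcon
      have h1 : ∑ y, ∫ ω, G y ω ∂σ.μ < ∑ _y : Fin T → Fin 2, (1 / 32 - ε) :=
        Finset.sum_lt_sum_of_nonempty Finset.univ_nonempty fun y _ => (hcon y).2
      simp only [Finset.sum_const, Finset.card_univ, Fintype.card_pi_const, Fintype.card_fin,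
        nsmul_eq_mul] at h1
      push_cast at h1
      linarith [hqN hT]
    · exact ⟨fun _ => 0, fun h => absurd h hT⟩
  refine ⟨L.relabel (informedEffort q ybar), ybar, fun y => ?_, fun hT => (hybar hT).trans
    (integral_benchmarkGain_le_policyRegret effortSetting br σ _ ybar hqmem)⟩
  filter_upwards [hL y] with ω hω
  have hle := fun p r => swapRegret_relabel_informedEffort_le hq1 L ybar y p r
  exact ⟨(hle _ _).trans (by linarith [hω.1]),
    fun p₀ hp₀ => (hle _ _).trans (by linarith [hω.2 p₀ hp₀])⟩

end PrincipalAgent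

end

theorem proposition1 :
    ∃ S : PrincipalAgent.LinearContractSetting (Fin 2) (Fin 2) (Fin 2),
      ∀ (br : PrincipalAgent.BestResponseRule S)
        (σ : (T : ℕ) → PrincipalAgent.Mechanism (Fin 2) (Fin 2) T),
        (¬ ∃ L : (T : ℕ) → PrincipalAgent.AgentAlgorithm (Fin 2) (Fin 2) T,
            PrincipalAgent.VanishingSwapRegret S br σ L) ∨
        (∃ L : (T : ℕ) → PrincipalAgent.AgentAlgorithm (Fin 2) (Fin 2) T,
            PrincipalAgent.VanishingSwapRegret S br σ L ∧
            ∃ ybar : (T : ℕ) → Fin T → Fin 2, ∃ c : ℝ, 0 < c ∧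
              ∀ᶠ T in Filter.atTop,
                c ≤ PrincipalAgent.policyRegret S br (σ T) (L T) (ybar T)) := by
  refine ⟨PrincipalAgent.effortSetting, fun br σ => ?_⟩
  rw [or_iff_not_imp_left, not_not]
  rintro ⟨L, ε, hε, hL⟩
  choose L' ybar hreg hpol using fun T =>
    PrincipalAgent.exists_algorithm_policyRegret_ge br (σ T) (L T) (hL T)
  -- Once `ε T < 1/64`, the bound `1/32 - ε T` exceeds 1/64.
  refine ⟨L', ⟨fun T => ε T + 2 / T, ?_, hreg⟩, ybar, 1 / 64, by norm_num, ?_⟩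
  · simpa using hε.add (tendsto_const_div_atTop_nhds_zero_nat 2)
  · filter_upwards [hε.eventually_lt_const (show (0 : ℝ) < 1 / 64 by norm_num),
      eventually_gt_atTop 0] with T hT hT0
    linarith [hpol T hT0]
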